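/- For integers $r_1,\dots,r_n\ge 1$ and the state space $\mathcal X=\prod_{i=1}^n\{0,\dots,r_i-1\}$ let $A^{(\mathcal X)}$ be the matrix with columns indexed by $\mathcal X$ whose rows are the constant function $1$ on $\mathcal X$ and the indicator functions of $\{x : x_i=y\}$ for $1\le i\le n$ and $1\le y\le r_i-1$. For $\mathcal Y=\prod_{j=1}^m\{0,\dots,s_j-1\}$ with integers $s_j\ge 1$ put $A^{(\mathcal X,\mathcal Y)}=A^{(\mathcal X)}\otimes A^{(\mathcal Y)}$, with columns indexed by $\mathcal X\times\mathcal Y$. The model $\mathrm{RBM}_{\mathcal X,\mathcal Y}\subset\mathbb R^{\mathcal X}$ is the set of all distributions $$p_\theta(x)=\frac1Z\sum_{y\in\mathcal Y}\exp\langle\theta,A^{(\mathcal X,\mathcal Y)}_{(x,y)}\rangle ,\qquad x\in\mathcal X,$$ where $\theta$ is a real parameter vector and $Z=Z(\theta)$ is the normalization constant. The tropical model $\mathrm{RBM}^{\mathrm{tropical}}_{\mathcal X,\mathcal Y}\subset\mathbb R^{\mathcal X}/\mathbb R\mathbf 1$ is the set of the classes, modulo constant functions, of the functions $v\mapsto\max_{h\in\mathcal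 Y}\langle\theta,A^{(\mathcal X,\mathcal Y)}_{(v,h)}\rangle$ on $\mathcal X$, over all $\theta$. The dimension of either set is its Hausdorff dimension (which here is the usual dimension of a semialgebraic or polyhedral set). $d_H$ denotes the Hamming distance, the Hamming ball of radius $\rho$ about $x$ is $\{y : d_H(x,y)\le\rho\}$ (empty if $\rho<0$), a set $\mathcal Z\subseteq\mathcal X$ has maximal rank if the columns $A^{(\mathcal X)}_x$, $x\in\mathcal Z$, form a matrix whose rank is the number of rows of $A^{(\mathcal X)}$, and $\mathfrak A_2(n,d)$ is the maximal cardinality of a set $C\subseteq\{0,1\}^n$ with $d_H(x,y)\ge d$ for all distinct $x,y\in C$. Proposition (binary visible units). Let $\mathcal X=\{0,1\}^n$. (1) Let $\mathcal Y=\prod_{j=1}^m\{0,\dots,s_j-1\}$ with $s_j\ge1$. If $\mathcal X$ contains $m$ pairwise disjoint Hamming balls of radii $2s_j-3$, $j=1,\dots,m$, such that the complement of their union has maximal rank, then $$\dim \mathrm{RBM}^{\mathrm{tropical}}_{\mathcal X,\mathcal Y}=\min\Big\{\sum_{j=1}^m(s_j-1)(n+1)+n,\;2^n-1\Big\}.$$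 (2) In particular, if $\mathcal Y=\{0,\dots,s-1\}^m$ with $s\ge 1$, and $m<\mathfrak A_2(n,4(s-1)-1)$, then $\mathrm{RBM}_{\mathcal X,\mathcal Y}$ has the expected dimension $$\dim \mathrm{RBM}_{\mathcal X,\mathcal Y}=\min\{m(s-1)(n+1)+n,\;2^n-1\}.$$ (3) For all integers $d$, with the convention that the upper index $n-1$ is read as $0$ if $n=0$, $$\mathfrak A_2(n,d)\ \ge\ 2^{\,n-\left\lceil\log_2\left(1+\sum_{j=0}^{d-2}\binom{n-1}{j}\right)\right\rceil}.$$ -/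

import Mathlib

open scoped Matrix Kronecker

/-- Joint states of `n` variables, the `i`-th one taking the states `0, …, r i - 1`. -/
abbrev States {n : ℕ} (r : Fin n → ℕ) : Type := ∀ i : Fin n, Fin (r i)

/-- The state spaces of `n` binary variables, so that `States (binary n)` is `{0,1}^n`. -/
abbrev binary (n : ℕ) : Fin n → ℕ := fun _ => 2

/-- Index set of the sufficient statistics of the independence model: `none` stands for the
constant function one, `some ⟨i, y⟩` for the indicator function of `{x | x i = y}`, where `y` is
a nonzero state of the `i`-th variable. -/
abbrev StatIndex {n : ℕ} (r : Fin n → ℕ) : Type :=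
  Option (Σ i : Fin n, {y : Fin (r i) // (y : ℕ) ≠ 0})

/-- The matrix `A^(X)` of sufficient statistics of the independence model on `States r`. -/
def indepStat {n : ℕ} (r : Fin n → ℕ) : Matrix (StatIndex r) (States r) ℝ
  | none, _ => 1
  | some ⟨i, y⟩, x => if x i = y then 1 else 0

/-- The matrix `A^(X,Y) = A^(X) ⊗ A^(Y)` of sufficient statistics of the graphical model with full
bipartite interactions between the visible units (with state spaces of sizes `r`) and the hidden
units (with state spaces of sizes `s`). -/
noncomputable def bipartiteStat {n m : ℕ} (r : Fin n → ℕ) (s : Fin m → ℕ) :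
    Matrix (StatIndex r × StatIndex s) (States r × States s) ℝ :=
  indepStat r ⊗ₖ indepStat s

/-- The joint distribution `p_θ(x,y) = exp ⟨θ, A_(x,y)⟩ / Z` with natural parameter `θ`. -/
noncomputable def jointDist {n m : ℕ} (r : Fin n → ℕ) (s : Fin m → ℕ)
    (θ : StatIndex r × StatIndex s → ℝ) : States r × States s → ℝ := fun z =>
  Real.exp ((θ ᵥ* bipartiteStat r s) z) / ∑ w, Real.exp ((θ ᵥ* bipartiteStat r s) w)

/-- The exponential family of the joint distributions of the visible and hidden units. -/
noncomputable def bipartiteModel {n m : ℕ} (r : Fin n → ℕ) (s : Fin m → ℕ) :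
    Set (States r × States s → ℝ) :=
  Set.range (jointDist r s)

/-- The discrete restricted Boltzmann machine: the set of the marginal distributions on the
visible states of the members of the exponential family, as a subset of `ℝ^X`. -/
noncomputable def RBM {n m : ℕ} (r : Fin n → ℕ) (s : Fin m → ℕ) : Set (States r → ℝ) :=
  (fun p x => ∑ y, p (x, y)) '' bipartiteModel r s

/-- The tropical morphism `Φ(v; θ) = max {⟨θ, A_(v,h)⟩ | h}`. -/
noncomputable def tropicalMorphism {n m : ℕ} (r : Fin n → ℕ) (s : Fin m → ℕ)
    (θ : StatIndex r × StatIndex s → ℝ) : States r → ℝ := fun v =>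
  ⨆ h : States s, (θ ᵥ* bipartiteStat r s) (v, h)

/-- The constant functions on the visible states. -/
def constants {n : ℕ} (r : Fin n → ℕ) : Submodule ℝ (States r → ℝ) := Submodule.span ℝ {1}

instance constants_isClosed {n : ℕ} (r : Fin n → ℕ) :
    IsClosed (constants r : Set (States r → ℝ)) :=
  have : FiniteDimensional ℝ (constants r) := inferInstance
  Submodule.closed_of_finiteDimensional _

/-- The tropical RBM: the image of the tropical morphism, where functions on the visible states
are considered up to additive constants; a subset of the normed space `ℝ^X / ℝ·1`. -/
noncomputable def tropicalRBM {n m : ℕ} (r : Fin n → ℕ) (s : Fin m → ℕ) :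
    Set ((States r → ℝ) ⧸ constants r) :=
  Set.range fun θ => (constants r).mkQ (tropicalMorphism r s θ)

/-- The Hamming ball with center `x` and radius `ρ` (empty if `ρ < 0`). -/
def hammingBall {n : ℕ} {r : Fin n → ℕ} (x : States r) (ρ : ℤ) : Finset (States r) :=
  Finset.univ.filter fun y => (hammingDist x y : ℤ) ≤ ρ

/-- A set `Z` of states has maximal rank if the columns of `A^(X)` with index in `Z` form a matrix
whose rank is the number of rows of `A^(X)`. -/
def HasMaximalRank {n : ℕ} {r : Fin n → ℕ} (Z : Finset (States r)) : Prop :=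
  ((indepStat r).submatrix id (fun z : Z => (z : States r))).rank = Fintype.card (StatIndex r)

/-- `𝔄(X, d)`: the maximal cardinality of a set of states whose distinct elements have pairwise
Hamming distance at least `d`. -/
noncomputable def maxCodeSize {n : ℕ} (r : Fin n → ℕ) (d : ℤ) : ℕ :=
  sSup {k | ∃ C : Finset (States r),
    (∀ x ∈ C, ∀ y ∈ C, x ≠ y → d ≤ (hammingDist x y : ℤ)) ∧ C.card = k}

open Filter Topology

/-! Fix a selection `σ` assigning a hidden state to every visible state. If some parameter makes `σ
v` the strict maximizer of the energy for all `v`, it does so on an open cone, where the tropical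
morphism is linear. If moreover the energies at `(v, σ v)` determine the parameter, that linear map
is injective and the image has dimension (number of parameters) - 1, one being lost to constants.
Deep inside the same cone, log-sum-exp differs from the maximum by a map with small Lipschitz
constant, so the RBM has this dimension too. The upper bounds are parameter counts.

On the cube, the distance to a center is an affine function of the sufficient statistics. Tangents
to a parabola in this distance make unit `j` take state `y ≥ 1` at distances `2y - 2, 2y - 1` from
its center, and state `0` outside its ball. Outside all balls only the block `(·, none)` acts, so
the rank hypothesis recovers it. Inside ball `j` the other units are in state `0`, and each pair of
consecutive spheres recovers one more block (`eq_zero_of_vecMul_activeStates`).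

For equal units, balls about all but one word of a code serve, the spare word providing the
complement. The code bound is Varshamov's greedy parity check construction with a pigeonhole on
syndromes. -/

lemma abs_exp_sub_exp_le {a b c : ℝ} (ha : a ≤ c) (hb : b ≤ c) :
    |Real.exp a - Real.exp b| ≤ Real.exp c * |a - b| := by
  wlog hab : b ≤ a generalizing a b
  · rw [abs_sub_comm, abs_sub_comm a]
    exact this hb ha (le_of_not_ge hab)
  rw [abs_of_nonneg (sub_nonneg.2 (Real.exp_le_exp.2 hab)), abs_of_nonneg (sub_nonneg.2 hab)]
  have h : Real.exp a - Real.exp b = Real.exp a * (1 - Real.exp (b - a)) := by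
    rw [mul_sub, ← Real.exp_add]
    ring_nf
  have h1 := Real.add_one_le_exp (b - a)
  calc Real.exp a - Real.exp b ≤ Real.exp a * (a - b) := by
        rw [h]
        exact mul_le_mul_of_nonneg_left (by linarith) (Real.exp_pos a).le
    _ ≤ _ := mul_le_mul_of_nonneg_right (Real.exp_le_exp.2 ha) (sub_nonneg.2 hab)

lemma abs_log_sub_log_le {a b : ℝ} (ha : 1 ≤ a) (hb : 1 ≤ b) :
    |Real.log a - Real.log b| ≤ |a - b| := by
  wlog hab : b ≤ a generalizing a b
  · rw [abs_sub_comm, abs_sub_comm a]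
    exact this hb ha (le_of_not_ge hab)
  have hb0 : 0 < b := by linarith
  rw [abs_of_nonneg (sub_nonneg.2 (Real.log_le_log hb0 hab)), abs_of_nonneg (sub_nonneg.2 hab),
    ← Real.log_div (by linarith) hb0.ne']
  calc Real.log (a / b) ≤ a / b - 1 := Real.log_le_sub_one_of_pos (by positivity)
    _ = (a - b) / b := by field_simp
    _ ≤ a - b := div_le_self (by linarith) hb

/-- A 1/2-Lipschitz perturbation of the identity shrinks distances at most by the factor 2, so it
cannot lower the dimension of an open set. -/
lemma finrank_le_dimH_image_of_contracting_sub_id {E : Type*} [NormedAddCommGroup E]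
    [NormedSpace ℝ E] [FiniteDimensional ℝ E] {U : Set E} (hU : IsOpen U) (hne : U.Nonempty)
    {f : E → E} (hf : ∀ x ∈ U, ∀ y ∈ U, ‖(f x - x) - (f y - y)‖ ≤ 1 / 2 * ‖x - y‖) :
    (Module.finrank ℝ E : ENNReal) ≤ dimH (f '' U) := by
  have h1 : AntilipschitzWith 2 (U.domRestrict f) := by
    refine AntilipschitzWith.of_le_mul_dist fun x y => ?_
    rw [Subtype.dist_eq, dist_eq_norm, dist_eq_norm]
    have h := hf x x.2 y y.2
    have h2 : ‖(x : E) - y‖ ≤ ‖f x - f y‖ + ‖(f x - x) - (f y - y)‖ := by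
      have := norm_sub_le (f x - f y) ((f x - x) - (f y - y))
      rwa [show f x - f y - ((f x - x) - (f y - y)) = (x : E) - y by abel] at this
    simp only [Set.domRestrict_apply, NNReal.coe_ofNat]
    linarith
  have h2 := h1.le_dimH_image Set.univ
  have h3 : dimH (Set.univ : Set U) = dimH U := by
    rw [← (isometry_subtype_coe (s := U)).dimH_image, Set.image_univ, Subtype.range_coe]
  rw [Set.image_univ, Set.range_domRestrict, h3,
    Real.dimH_of_nonempty_interior (by rwa [hU.interior_eq])] at h2
  exact h2

/-! ### Lower dimension bounds from a strict selection -/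

section Selection

variable {E V H : Type*} [NormedAddCommGroup E] [NormedSpace ℝ E] [FiniteDimensional ℝ E]
  [Fintype V] [Fintype H]

/-- On the open set where `σ` is the strict maximizer, `T` undoes the maximum exactly, so the range
contains that set. -/
lemma finrank_le_dimH_range_iSup (A : E →L[ℝ] (V → H → ℝ)) (σ : V → H)
    (T : (V → ℝ) →L[ℝ] E) (hT : ∀ x, T (fun v => A x v (σ v)) = x) (x₀ : E)
    (hx₀ : ∀ v h, h ≠ σ v → A x₀ v h < A x₀ v (σ v)) :
    (Module.finrank ℝ E : ENNReal) ≤ dimH (Set.range fun x => T fun v => ⨆ h, A x v h) := by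
  set U : Set E := {x | ∀ v h, h ≠ σ v → A x v h < A x v (σ v)} with hUdef
  have hU : IsOpen U := by
    have : U = ⋂ v, ⋂ h, ⋂ _ : h ≠ σ v, {x | A x v h < A x v (σ v)} := by
      ext x
      simp [hUdef]
    rw [this]
    exact isOpen_iInter_of_finite fun v => isOpen_iInter_of_finite fun h =>
      isOpen_iInter_of_finite fun _ => isOpen_lt (by fun_prop) (by fun_prop)
  rw [← Real.dimH_of_nonempty_interior (s := U) (by rw [hU.interior_eq]; exact ⟨x₀, hx₀⟩)]
  refine dimH_mono fun x hx => ⟨x, ?_⟩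
  have h1 : (fun v => ⨆ h, A x v h) = fun v => A x v (σ v) := by
    funext v
    have : Nonempty H := ⟨σ v⟩
    refine le_antisymm (ciSup_le fun h => ?_)
      (le_ciSup (f := fun h => A x v h) (Set.finite_range _).bddAbove (σ v))
    by_cases hh : h = σ v
    · rw [hh]
    · exact (hx v h hh).le
  simp only [h1, hT]

/-- Where every competitor of `σ v` trails by more than `M`, replacing the maximum by log-sum-exp
adds an error whose Lipschitz constant is of order `exp (-M)`. -/
lemma finrank_le_dimH_range_log_sum_exp (A : E →L[ℝ] (V → H → ℝ)) (σ : V → H)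
    (T : (V → ℝ) →L[ℝ] E) (hT : ∀ x, T (fun v => A x v (σ v)) = x) (x₀ : E)
    (hx₀ : ∀ v h, h ≠ σ v → A x₀ v h < A x₀ v (σ v)) :
    (Module.finrank ℝ E : ENNReal) ≤
      dimH (Set.range fun x => T fun v => Real.log (∑ h, Real.exp (A x v h))) := by
  set c : ℝ := 2 * ‖A‖ with hc
  have hlip : ∀ x y v h, |(A x v h - A x v (σ v)) - (A y v h - A y v (σ v))| ≤ c * ‖x - y‖ := by
    intro x y v h
    have h1 : ∀ h, |A (x - y) v h| ≤ ‖A‖ * ‖x - y‖ := fun h =>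
      ((norm_le_pi_norm (A (x - y) v) h).trans (norm_le_pi_norm (A (x - y)) v)).trans
        (A.le_opNorm _)
    have h2 : (A x v h - A x v (σ v)) - (A y v h - A y v (σ v))
        = A (x - y) v h - A (x - y) v (σ v) := by
      rw [map_sub]
      simp only [Pi.sub_apply]
      ring
    rw [h2, hc]
    have := abs_sub (A (x - y) v h) (A (x - y) v (σ v))
    linarith [h1 h, h1 (σ v)]
  have hc0 : 0 ≤ c := by positivity
  -- The product is the Lipschitz constant of the error obtained below: one factor `exp (-M) * c`
  -- per competitor, then the norm of `T`.
  obtain ⟨M, hM⟩ : ∃ M : ℝ, ‖T‖ * (Fintype.card H * (Real.exp (-M) * c)) ≤ 1 / 2 := by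
    have h : Tendsto (fun M : ℝ => ‖T‖ * (Fintype.card H * (Real.exp (-M) * c))) atTop
        (𝓝 (‖T‖ * (Fintype.card H * (0 * c)))) :=
      ((Real.tendsto_exp_neg_atTop_nhds_zero.mul_const c).const_mul _).const_mul _
    have h0 : ‖T‖ * (Fintype.card H * (0 * c)) < 1 / 2 := by norm_num
    exact ((h.eventually_lt_const h0).exists).imp fun _ h => h.le
  set U : Set E := {x | ∀ v h, h ≠ σ v → A x v h - A x v (σ v) < -M} with hUdef
  have hU : IsOpen U := by
    have : U = ⋂ v, ⋂ h, ⋂ _ : h ≠ σ v, {x | A x v h - A x v (σ v) < -M} := by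
      ext x
      simp [hUdef]
    rw [this]
    exact isOpen_iInter_of_finite fun v => isOpen_iInter_of_finite fun h =>
      isOpen_iInter_of_finite fun _ => isOpen_lt (by fun_prop) (by fun_prop)
  -- The gaps are homogeneous in the parameter, so a large multiple of `x₀` has all gaps beyond `M`.
  have hne : U.Nonempty := by
    have h : ∀ᶠ t : ℝ in atTop, ∀ v h, h ≠ σ v →
        t * (A x₀ v h - A x₀ v (σ v)) < -M := by
      refine eventually_all.2 fun v => eventually_all.2 fun h => eventually_imp_distrib_left.2
        fun hh => ?_
      exact (tendsto_id.atTop_mul_const_of_neg (sub_neg.2 (hx₀ v h hh))).eventually_lt_atBot _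
    obtain ⟨t, ht⟩ := h.exists
    refine ⟨t • x₀, fun v h hh => ?_⟩
    have := ht v h hh
    rw [map_smul]
    simpa [mul_sub] using this
  refine (finrank_le_dimH_image_of_contracting_sub_id hU hne
    (f := fun x => T fun v => Real.log (∑ h, Real.exp (A x v h))) ?_).trans
    (dimH_mono (Set.image_subset_range _ _))
  intro x hx y hy
  have key : ∀ x, (T fun v => Real.log (∑ h, Real.exp (A x v h))) - x
      = T fun v => Real.log (∑ h, Real.exp (A x v h - A x v (σ v))) := by
    intro x
    nth_rewrite 2 [← hT x]
    rw [← map_sub]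
    congr 1
    funext v
    simp only [Pi.sub_apply, Real.exp_sub, ← Finset.sum_div]
    rw [Real.log_div (Finset.sum_pos (fun _ _ => Real.exp_pos _) ⟨σ v, Finset.mem_univ _⟩).ne'
      (Real.exp_pos _).ne', Real.log_exp]
  -- The term `h = σ v` equals 1, which keeps the sums where the logarithm is 1-Lipschitz.
  have hone : ∀ x v, 1 ≤ ∑ h, Real.exp (A x v h - A x v (σ v)) := by
    intro x v
    have := Finset.single_le_sum (f := fun h => Real.exp (A x v h - A x v (σ v)))
      (fun _ _ => (Real.exp_pos _).le) (Finset.mem_univ (σ v))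
    simpa using this
  rw [key, key, ← map_sub]
  refine (T.le_opNorm _).trans ?_
  refine le_trans (mul_le_mul_of_nonneg_left ?_ (norm_nonneg T))
    ((mul_assoc ‖T‖ (Fintype.card H * (Real.exp (-M) * c)) ‖x - y‖).symm.le.trans
      (mul_le_mul_of_nonneg_right hM (norm_nonneg _)))
  refine (pi_norm_le_iff_of_nonneg (by positivity)).2 fun v => ?_
  refine (abs_log_sub_log_le (hone x v) (hone y v)).trans ?_
  rw [← Finset.sum_sub_distrib]
  refine (Finset.abs_sum_le_sum_abs _ _).trans ?_
  have hterm : ∀ h ∈ Finset.univ, |Real.exp (A x v h - A x v (σ v)) -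
      Real.exp (A y v h - A y v (σ v))| ≤ Real.exp (-M) * c * ‖x - y‖ := by
    intro h _
    by_cases hh : h = σ v
    · rw [hh]
      simp only [sub_self, abs_zero]
      positivity
    · refine (abs_exp_sub_exp_le (hx v h hh).le (hy v h hh).le).trans ?_
      rw [mul_assoc]
      exact mul_le_mul_of_nonneg_left (hlip x y v h) (Real.exp_pos _).le
  refine (Finset.sum_le_card_nsmul _ _ _ hterm).trans ?_
  rw [nsmul_eq_mul, Finset.card_univ]
  exact le_of_eq (by ring)

end Selection


/-! ### Dimension of hidden variable models, with the constant row `i₀` removed -/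

section HiddenVariables

variable {I V H : Type*} [DecidableEq I]

/-- Extension of a parameter vector by zero at the coordinate `i₀`. -/
def extendByZero (i₀ : I) : ({i // i ≠ i₀} → ℝ) →ₗ[ℝ] (I → ℝ) where
  toFun x i := if h : i ≠ i₀ then x ⟨i, h⟩ else 0
  map_add' x y := by
    funext i
    by_cases h : i = i₀ <;> simp [h]
  map_smul' t x := by
    funext i
    by_cases h : i = i₀ <;> simp [h]

lemma extendByZero_apply_of_ne {i₀ : I} (x : {i // i ≠ i₀} → ℝ) (i : {i // i ≠ i₀}) :
    extendByZero i₀ x i = x i :=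
  dif_pos i.2

lemma extendByZero_restrict_add (i₀ : I) (θ : I → ℝ) :
    θ = extendByZero i₀ (fun i => θ i) + θ i₀ • Pi.single i₀ 1 := by
  funext i
  by_cases h : i = i₀
  · subst h
    simp [extendByZero]
  · simp [extendByZero, h]

variable [Fintype I]

/-- The energies `⟨θ, B_(v,h)⟩`, as a function of the parameters other than the one at `i₀`. -/
noncomputable def reducedEnergy [Fintype V] [Fintype H] (B : Matrix I (V × H) ℝ) (i₀ : I) :
    ({i // i ≠ i₀} → ℝ) →L[ℝ] (V → H → ℝ) :=
  LinearMap.toContinuousLinearMap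
    { toFun := fun x v h => (extendByZero i₀ x ᵥ* B) (v, h)
      map_add' := fun x y => by
        funext v h
        simp [Matrix.add_vecMul]
      map_smul' := fun t x => by
        funext v h
        simp [Matrix.smul_vecMul] }

lemma reducedEnergy_apply [Fintype V] [Fintype H] (B : Matrix I (V × H) ℝ) (i₀ : I)
    (x : {i // i ≠ i₀} → ℝ) (v : V)
    (h : H) : reducedEnergy B i₀ x v h = (extendByZero i₀ x ᵥ* B) (v, h) := rfl

variable [Fintype V] [Fintype H] {B : Matrix I (V × H) ℝ} {i₀ : I}

lemma vecMul_eq_reducedEnergy_add (hB : ∀ z, B i₀ z = 1) (θ : I → ℝ) (v : V) (h : H) :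
    (θ ᵥ* B) (v, h) = reducedEnergy B i₀ (fun i => θ i) v h + θ i₀ := by
  nth_rewrite 1 [extendByZero_restrict_add i₀ θ]
  rw [Matrix.add_vecMul, Matrix.smul_vecMul, Matrix.single_one_vecMul, reducedEnergy_apply]
  simp [hB]

lemma exists_leftInverse_selection (hB : ∀ z, B i₀ z = 1) (σ : V → H)
    (hσ : ∀ θ : I → ℝ, (∀ v, (θ ᵥ* B) (v, σ v) = 0) → θ = 0)
    {Q : Type*} [AddCommGroup Q] [Module ℝ Q] (q : (V → ℝ) →ₗ[ℝ] Q)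
    (hq : LinearMap.ker q = Submodule.span ℝ {1}) :
    ∃ S : Q →ₗ[ℝ] ({i // i ≠ i₀} → ℝ),
      ∀ x, S (q fun v => reducedEnergy B i₀ x v (σ v)) = x := by
  let L : ({i // i ≠ i₀} → ℝ) →ₗ[ℝ] Q :=
    { toFun := fun x => q fun v => reducedEnergy B i₀ x v (σ v)
      map_add' := fun x y => by
        rw [← map_add]
        congr 1
        funext v
        simp
      map_smul' := fun t x => by
        rw [← map_smul]
        congr 1
        funext v
        simp }
  have hL : LinearMap.ker L = ⊥ := by
    refine LinearMap.ker_eq_bot'.2 fun x hx => ?_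
    have hx' : (fun v => reducedEnergy B i₀ x v (σ v)) ∈ LinearMap.ker q := hx
    rw [hq] at hx'
    obtain ⟨t, ht⟩ := Submodule.mem_span_singleton.1 hx'
    -- A constant value `t` of the selected energies is cancelled through the constant row, so `hσ`
    -- applies to the full vector.
    have h0 : extendByZero i₀ x - t • Pi.single i₀ 1 = 0 := by
      refine hσ _ fun v => ?_
      have := congrFun ht v
      rw [Matrix.sub_vecMul, Matrix.smul_vecMul, Matrix.single_one_vecMul]
      simp only [Pi.smul_apply, Pi.one_apply, smul_eq_mul, mul_one, Pi.sub_apply,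
        Matrix.row_apply, hB] at this ⊢
      rw [this, reducedEnergy_apply, sub_self]
    funext i
    have := congrFun h0 i
    rw [Pi.sub_apply, extendByZero_apply_of_ne] at this
    simpa [i.2] using this
  obtain ⟨S, hS⟩ := L.exists_leftInverse_of_injective hL
  exact ⟨S, fun x => LinearMap.congr_fun hS x⟩

lemma reducedEnergy_restrict_lt (hB : ∀ z, B i₀ z = 1) {σ : V → H} {θ : I → ℝ}
    (hθ : ∀ v h, h ≠ σ v → (θ ᵥ* B) (v, h) < (θ ᵥ* B) (v, σ v)) (v : V) (h : H) (hh : h ≠ σ v) :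
    reducedEnergy B i₀ (fun i => θ i) v h < reducedEnergy B i₀ (fun i => θ i) v (σ v) := by
  have := hθ v h hh
  rw [vecMul_eq_reducedEnergy_add hB, vecMul_eq_reducedEnergy_add hB] at this
  linarith

/-- The upper bound covers the image by finitely many linear images, one per selection `f`. The
lower bound transports the image by the Lipschitz map `S`. -/
lemma dimH_range_iSup_vecMul [Nonempty H] (hB : ∀ z, B i₀ z = 1) (σ : V → H)
    (hσ : ∀ θ : I → ℝ, (∀ v, (θ ᵥ* B) (v, σ v) = 0) → θ = 0) {θ₀ : I → ℝ}
    (hθ₀ : ∀ v h, h ≠ σ v → (θ₀ ᵥ* B) (v, h) < (θ₀ ᵥ* B) (v, σ v))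
    {Q : Type*} [NormedAddCommGroup Q] [NormedSpace ℝ Q] (q : (V → ℝ) →ₗ[ℝ] Q)
    (hq : LinearMap.ker q = Submodule.span ℝ {1}) (hsurj : Function.Surjective q) :
    dimH (Set.range fun θ : I → ℝ => q fun v => ⨆ h, (θ ᵥ* B) (v, h)) =
      ((Fintype.card I - 1 : ℕ) : ENNReal) := by
  have hcard : Module.finrank ℝ ({i // i ≠ i₀} → ℝ) = Fintype.card I - 1 := by
    rw [Module.finrank_fintype_fun_eq_card, Fintype.card_subtype_compl,
      Fintype.card_subtype_eq]
  rw [← hcard]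
  have : FiniteDimensional ℝ Q := Module.Finite.of_surjective q hsurj
  have hq1 : q 1 = 0 := by
    rw [← LinearMap.mem_ker, hq]
    exact Submodule.mem_span_singleton_self _
  have hrange : (Set.range fun θ : I → ℝ => q fun v => ⨆ h, (θ ᵥ* B) (v, h)) =
      Set.range fun x => q fun v => ⨆ h, reducedEnergy B i₀ x v h := by
    refine Set.Subset.antisymm ?_ ?_
    · rintro _ ⟨θ, rfl⟩
      refine ⟨fun i => θ i, ?_⟩
      have : (fun v => ⨆ h, (θ ᵥ* B) (v, h)) =
          (fun v => ⨆ h, reducedEnergy B i₀ (fun i => θ i) v h) + θ i₀ • 1 := by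
        funext v
        simp only [vecMul_eq_reducedEnergy_add hB, Pi.add_apply, Pi.smul_apply, Pi.one_apply,
          smul_eq_mul, mul_one]
        rw [ciSup_add (Set.finite_range _).bddAbove]
      simp only [this, map_add, map_smul, hq1, smul_zero, add_zero]
    · rintro _ ⟨x, rfl⟩
      exact ⟨extendByZero i₀ x, rfl⟩
  rw [hrange]
  refine le_antisymm ?_ ?_
  · have hsub : (Set.range fun x => q fun v => ⨆ h, reducedEnergy B i₀ x v h) ⊆
        ⋃ f : V → H, Set.range fun x => q fun v => reducedEnergy B i₀ x v (f v) := by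
      rintro _ ⟨x, rfl⟩
      have hmax : ∀ v, ∃ h, reducedEnergy B i₀ x v h = ⨆ h, reducedEnergy B i₀ x v h :=
        fun v => exists_eq_ciSup_of_finite
      choose f hf using hmax
      refine Set.mem_iUnion.2 ⟨f, x, ?_⟩
      simp only [hf]
    refine (dimH_mono hsub).trans ?_
    rw [dimH_iUnion]
    refine iSup_le fun f => ContDiff.dimH_range_le ?_
    have h1 : ContDiff ℝ 1 (LinearMap.toContinuousLinearMap q) :=
      ContinuousLinearMap.contDiff _
    exact h1.comp (f := fun x v => reducedEnergy B i₀ x v (f v)) (by fun_prop)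
  · obtain ⟨S, hS⟩ := exists_leftInverse_selection hB σ hσ q hq
    refine (finrank_le_dimH_range_iSup (reducedEnergy B i₀) σ
      (LinearMap.toContinuousLinearMap (S ∘ₗ q)) hS (fun i => θ₀ i)
      (reducedEnergy_restrict_lt hB hθ₀)).trans ?_
    have := (LinearMap.toContinuousLinearMap S).lipschitz.dimH_image_le
      (Set.range fun x => q fun v => ⨆ h, reducedEnergy B i₀ x v h)
    rw [← Set.range_comp] at this
    exact this

/-- The parametrization is smooth, whence the upper bound. For the lower one, take logarithms: `log
Z` is a constant function, which `T` kills, and log-sum-exp remains. -/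
lemma dimH_range_marginal [Nonempty V] [Nonempty H] (hB : ∀ z, B i₀ z = 1) (σ : V → H)
    (hσ : ∀ θ : I → ℝ, (∀ v, (θ ᵥ* B) (v, σ v) = 0) → θ = 0) {θ₀ : I → ℝ}
    (hθ₀ : ∀ v h, h ≠ σ v → (θ₀ ᵥ* B) (v, h) < (θ₀ ᵥ* B) (v, σ v)) :
    dimH (Set.range fun (θ : I → ℝ) (v : V) =>
        ∑ h, Real.exp ((θ ᵥ* B) (v, h)) / ∑ w, Real.exp ((θ ᵥ* B) w)) =
      ((Fintype.card I - 1 : ℕ) : ENNReal) := by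
  have hcard : Module.finrank ℝ ({i // i ≠ i₀} → ℝ) = Fintype.card I - 1 := by
    rw [Module.finrank_fintype_fun_eq_card, Fintype.card_subtype_compl,
      Fintype.card_subtype_eq]
  rw [← hcard]
  set P : ({i // i ≠ i₀} → ℝ) → V → ℝ := fun x v =>
    ∑ h, Real.exp (reducedEnergy B i₀ x v h) / ∑ w : V × H, Real.exp (reducedEnergy B i₀ x w.1 w.2)
    with hP
  have hZ : ∀ x, 0 < ∑ w : V × H, Real.exp (reducedEnergy B i₀ x w.1 w.2) := fun x =>
    Finset.sum_pos (fun _ _ => Real.exp_pos _) Finset.univ_nonempty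
  have hN : ∀ x v, 0 < ∑ h, Real.exp (reducedEnergy B i₀ x v h) := fun x v =>
    Finset.sum_pos (fun _ _ => Real.exp_pos _) Finset.univ_nonempty
  have hrange : (Set.range fun (θ : I → ℝ) (v : V) =>
      ∑ h, Real.exp ((θ ᵥ* B) (v, h)) / ∑ w, Real.exp ((θ ᵥ* B) w)) = Set.range P := by
    refine Set.Subset.antisymm ?_ ?_
    · rintro _ ⟨θ, rfl⟩
      refine ⟨fun i => θ i, ?_⟩
      funext v
      refine Finset.sum_congr rfl fun h _ => ?_
      have hw : ∀ w : V × H, (θ ᵥ* B) w = reducedEnergy B i₀ (fun i => θ i) w.1 w.2 + θ i₀ :=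
        fun w => vecMul_eq_reducedEnergy_add hB θ w.1 w.2
      simp only [hw, Real.exp_add, ← Finset.sum_mul]
      rw [mul_div_mul_right _ _ (Real.exp_pos _).ne']
    · rintro _ ⟨x, rfl⟩
      exact ⟨extendByZero i₀ x, rfl⟩
  rw [hrange]
  refine le_antisymm (ContDiff.dimH_range_le ?_) ?_
  · refine contDiff_pi.2 fun v => ContDiff.sum fun h _ => ContDiff.div ?_ ?_ fun x => (hZ x).ne'
    · exact Real.contDiff_exp.comp (by fun_prop)
    · exact ContDiff.sum fun w _ => Real.contDiff_exp.comp (by fun_prop)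
  · obtain ⟨S, hS⟩ := exists_leftInverse_selection hB σ hσ (Submodule.span ℝ {(1 : V → ℝ)}).mkQ
      (Submodule.ker_mkQ _)
    set T := LinearMap.toContinuousLinearMap (S ∘ₗ (Submodule.span ℝ {(1 : V → ℝ)}).mkQ) with hT
    have hT1 : T 1 = 0 := by
      have : (Submodule.span ℝ {(1 : V → ℝ)}).mkQ 1 = 0 := by
        rw [← LinearMap.mem_ker, Submodule.ker_mkQ]
        exact Submodule.mem_span_singleton_self _
      simp [hT, this]
    refine (finrank_le_dimH_range_log_sum_exp (reducedEnergy B i₀) σ T hS (fun i => θ₀ i)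
      (reducedEnergy_restrict_lt hB hθ₀)).trans ?_
    have hpos : Set.range P ⊆ {p : V → ℝ | ∀ v, 0 < p v} := by
      rintro _ ⟨x, rfl⟩ v
      simp only [hP, ← Finset.sum_div]
      exact div_pos (hN x v) (hZ x)
    have hconv : Convex ℝ {p : V → ℝ | ∀ v, 0 < p v} := by
      intro p hp p' hp' a b ha hb hab v
      exact convex_Ioi (0 : ℝ) (hp v) (hp' v) ha hb hab
    have hsmooth : ContDiffOn ℝ 1 (fun p : V → ℝ => T fun v => Real.log (p v))
        {p : V → ℝ | ∀ v, 0 < p v} := by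
      refine T.contDiff.comp_contDiffOn (contDiffOn_pi.2 fun v => ContDiffOn.log ?_ ?_)
      · exact (contDiff_apply ℝ ℝ v).contDiffOn
      · exact fun p hp => (hp v).ne'
    refine le_trans (le_of_eq ?_) (hsmooth.dimH_image_le hconv hpos)
    rw [← Set.range_comp]
    congr 2
    funext x
    have : (fun v => Real.log (P x v)) = (fun v => Real.log (∑ h, Real.exp
        (reducedEnergy B i₀ x v h))) - Real.log (∑ w : V × H, Real.exp
          (reducedEnergy B i₀ x w.1 w.2)) • 1 := by
      funext v
      simp only [hP, ← Finset.sum_div]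
      rw [Real.log_div (hN x v).ne' (hZ x).ne']
      simp
    simp only [Function.comp_apply, this, map_sub, map_smul, hT1, smul_zero, sub_zero]

end HiddenVariables

lemma card_le_card_of_selection_injective {I V H : Type*} [Fintype I] [Fintype V]
    {B : Matrix I (V × H) ℝ} (σ : V → H)
    (hσ : ∀ θ : I → ℝ, (∀ v, (θ ᵥ* B) (v, σ v) = 0) → θ = 0) :
    Fintype.card I ≤ Fintype.card V := by
  let L : (I → ℝ) →ₗ[ℝ] (V → ℝ) :=
    { toFun := fun θ v => (θ ᵥ* B) (v, σ v)
      map_add' := fun x y => by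
        funext v
        simp [Matrix.add_vecMul]
      map_smul' := fun t x => by
        funext v
        simp [Matrix.smul_vecMul] }
  have hL : Function.Injective L :=
    (injective_iff_map_eq_zero L).2 fun θ h => hσ θ fun v => congrFun h v
  simpa using LinearMap.finrank_le_finrank_of_injective hL

/-! ### The Gilbert–Varshamov bound -/

section GilbertVarshamov

lemma bddAbove_codeSizes {n : ℕ} (r : Fin n → ℕ) (d : ℤ) :
    BddAbove {k | ∃ C : Finset (States r),
      (∀ x ∈ C, ∀ y ∈ C, x ≠ y → d ≤ (hammingDist x y : ℤ)) ∧ C.card = k} :=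
  ⟨Fintype.card (States r), by
    rintro _ ⟨C, -, rfl⟩
    exact C.card_le_univ⟩

lemma card_le_maxCodeSize {n : ℕ} {r : Fin n → ℕ} {d : ℤ} {C : Finset (States r)}
    (hC : ∀ x ∈ C, ∀ y ∈ C, x ≠ y → d ≤ (hammingDist x y : ℤ)) : C.card ≤ maxCodeSize r d :=
  le_csSup (bddAbove_codeSizes r d) ⟨C, hC, rfl⟩

lemma exists_card_eq_maxCodeSize {n : ℕ} (r : Fin n → ℕ) (d : ℤ) :
    ∃ C : Finset (States r), (∀ x ∈ C, ∀ y ∈ C, x ≠ y → d ≤ (hammingDist x y : ℤ)) ∧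
      C.card = maxCodeSize r d :=
  Nat.sSup_mem (s := {k | ∃ C : Finset (States r),
    (∀ x ∈ C, ∀ y ∈ C, x ≠ y → d ≤ (hammingDist x y : ℤ)) ∧ C.card = k})
    ⟨0, ∅, by simp, rfl⟩ (bddAbove_codeSizes r d)

lemma card_filter_card_le {α : Type*} [Fintype α] [DecidableEq α] (e : ℕ) :
    (Finset.univ.filter fun S : Finset α => S.card < e).card =
      ∑ j ∈ Finset.range e, (Fintype.card α).choose j := by
  have : (Finset.univ.filter fun S : Finset α => S.card < e) =
      (Finset.range e).biUnion fun j => Finset.powersetCard j Finset.univ := by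
    ext S
    simp [Finset.mem_powersetCard]
  rw [this, Finset.card_biUnion]
  · simp
  · intro i _ j _ hij
    exact Finset.pairwise_disjoint_powersetCard _ hij

/-- Greedy choice of the columns of a parity check matrix: any `k ≤ n` columns, no nonempty
family of at most `e` of which sums to zero. -/
lemma exists_parityCheck_columns {W : Type*} [AddCommGroup W] [Fintype W] {n e : ℕ}
    (hW : ∑ j ∈ Finset.range e, (n - 1).choose j < Fintype.card W) (k : ℕ) (hk : k ≤ n) :
    ∃ g : Fin k → W, ∀ S : Finset (Fin k), S.Nonempty → S.card ≤ e → ∑ i ∈ S, g i ≠ 0 := by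
  classical
  induction k with
  | zero => exact ⟨fun i => i.elim0, fun S hS => (hS.choose.elim0)⟩
  | succ k ih =>
    obtain ⟨g, hg⟩ := ih (by omega)
    -- A new column is bad only if it is the negative of a sum of fewer than `e` earlier ones. There
    -- are at most `n - 1` earlier columns, hence the upper index of the binomials.
    have hbad : ((Finset.univ.filter fun S : Finset (Fin k) => S.card < e).image
        fun S => -∑ i ∈ S, g i).card < Fintype.card W := by
      refine Finset.card_image_le.trans_lt (lt_of_le_of_lt ?_ hW)
      rw [card_filter_card_le, Fintype.card_fin]
      exact Finset.sum_le_sum fun j _ => Nat.choose_le_choose j (by omega)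
    obtain ⟨w, hw⟩ : ∃ w, w ∉ (Finset.univ.filter fun S : Finset (Fin k) => S.card < e).image
        fun S => -∑ i ∈ S, g i := by
      by_contra! h
      rw [Finset.eq_univ_iff_forall.2 h, Finset.card_univ] at hbad
      exact lt_irrefl _ hbad
    refine ⟨Fin.snoc g w, fun S hS hcard hsum => ?_⟩
    set S' : Finset (Fin k) := Finset.univ.filter fun i => i.castSucc ∈ S with hS'
    have hmap : S.erase (Fin.last k) = S'.map Fin.castSuccEmb := by
      ext i
      refine Fin.lastCases ?_ (fun i => ?_) i <;> simp [hS', Fin.castSucc_ne_last]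
    have hsum' : ∑ i ∈ S.erase (Fin.last k), (Fin.snoc g w : Fin (k + 1) → W) i =
        ∑ i ∈ S', g i := by
      rw [hmap, Finset.sum_map]
      simp
    by_cases hl : Fin.last k ∈ S
    · have hc := Finset.card_erase_of_mem hl
      rw [hmap, Finset.card_map] at hc
      have hpos := Finset.card_pos.2 hS
      rw [← Finset.add_sum_erase _ _ hl, hsum', Fin.snoc_last] at hsum
      refine hw (Finset.mem_image.2 ⟨S', ?_, ?_⟩)
      · simp only [Finset.mem_filter, Finset.mem_univ, true_and]
        omega
      · exact (eq_neg_of_add_eq_zero_left hsum).symm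
    · rw [Finset.erase_eq_of_notMem hl] at hmap hsum'
      refine hg S' ?_ ?_ (hsum' ▸ hsum)
      · rw [hmap] at hS
        exact Finset.map_nonempty.1 hS
      · rwa [hmap, Finset.card_map] at hcard

/-- Two words with equal syndrome differ in positions whose columns sum to zero, hence in more than
`e` positions. So each of the `2 ^ R` syndrome fibres is a code of distance `d`, and together they
fill the cube. -/
lemma two_pow_le_maxCodeSize_mul {n e R : ℕ} {d : ℤ} (hd : d ≤ e + 1)
    (hR : ∑ j ∈ Finset.range e, (n - 1).choose j < 2 ^ R) :
    2 ^ n ≤ maxCodeSize (binary n) d * 2 ^ R := by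
  classical
  have hcard : Fintype.card (Fin R → ZMod 2) = 2 ^ R := by simp [ZMod.card]
  obtain ⟨g, hg⟩ := exists_parityCheck_columns (W := Fin R → ZMod 2) (by rwa [hcard]) n le_rfl
  let syn : States (binary n) → (Fin R → ZMod 2) := fun x => ∑ i, if x i = 1 then g i else 0
  have hfib : ∀ w ∈ (Finset.univ : Finset (Fin R → ZMod 2)),
      (Finset.univ.filter fun x => syn x = w).card ≤ maxCodeSize (binary n) d := by
    intro w _
    refine card_le_maxCodeSize fun x hx y hy hxy => ?_
    simp only [Finset.mem_filter, Finset.mem_univ, true_and] at hx hy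
    by_contra! hlt
    refine hg (Finset.univ.filter fun i => x i ≠ y i) ?_ ?_ ?_
    · obtain ⟨i, hi⟩ := Function.ne_iff.1 hxy
      exact ⟨i, by simpa using hi⟩
    · have : (Finset.univ.filter fun i => x i ≠ y i).card = hammingDist x y := rfl
      omega
    · have h2 : ∀ u : Fin R → ZMod 2, u + u = 0 := fun u =>
        funext fun j => CharTwo.add_self_eq_zero _
      have h0 : syn x + syn y = 0 := by rw [hx, hy, h2]
      refine Eq.trans ?_ h0
      rw [Finset.sum_filter, ← Finset.sum_add_distrib]
      refine Finset.sum_congr rfl fun i _ => ?_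
      rcases Fin.exists_fin_two.1 ⟨x i, rfl⟩ with hxi | hxi <;>
        rcases Fin.exists_fin_two.1 ⟨y i, rfl⟩ with hyi | hyi <;> simp [hxi, hyi, h2]
  have := Finset.card_le_mul_card_image_of_maps_to (s := Finset.univ) (f := syn)
    (t := Finset.univ) (fun _ _ => Finset.mem_univ _) _ hfib
  simpa [hcard] using this

lemma gilbert_varshamov (n : ℕ) (d : ℤ) :
    (2 : ℝ) ^ ((n : ℤ) -
        ⌈Real.logb 2 (1 + ∑ j ∈ Finset.range (d - 1).toNat, ((n - 1).choose j : ℝ))⌉) ≤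
      (maxCodeSize (binary n) d : ℝ) := by
  set N : ℕ := ∑ j ∈ Finset.range (d - 1).toNat, (n - 1).choose j with hN
  have hcast : (1 + ∑ j ∈ Finset.range (d - 1).toNat, ((n - 1).choose j : ℝ)) = 1 + (N : ℝ) := by
    rw [hN]
    push_cast
    rfl
  rw [hcast]
  have hN0 : (1 : ℝ) ≤ 1 + N := by linarith [N.cast_nonneg (α := ℝ)]
  have hlog : 0 ≤ Real.logb 2 (1 + N) := Real.logb_nonneg (by norm_num) hN0
  obtain ⟨R, hR⟩ := Int.eq_ofNat_of_zero_le (Int.ceil_nonneg hlog)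
  rw [hR]
  have hle : Real.logb 2 (1 + N) ≤ R := by
    have := Int.le_ceil (Real.logb 2 (1 + (N : ℝ)))
    rw [hR] at this
    exact_mod_cast this
  have hlt : N < 2 ^ R := by
    rw [Real.logb_le_iff_le_rpow (by norm_num) (by linarith), Real.rpow_natCast] at hle
    have : 1 + N ≤ 2 ^ R := by exact_mod_cast hle
    omega
  have key : (2 : ℝ) ^ n ≤ maxCodeSize (binary n) d * 2 ^ R := by
    exact_mod_cast two_pow_le_maxCodeSize_mul (e := (d - 1).toNat) (by omega) hlt
  rw [zpow_sub₀ (by norm_num), zpow_natCast, zpow_natCast]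
  exact div_le_of_le_mul₀ (by positivity) (by positivity) key

end GilbertVarshamov

/-! ### Energies and maximal rank in coordinates -/

section IndependenceModel

/-- The contribution of the state `y` of the `i`-th variable to the pairing of `ψ` with a column
of `indepStat r`. -/
def coordTerm {n : ℕ} {r : Fin n → ℕ} (ψ : StatIndex r → ℝ) (i : Fin n) (y : Fin (r i)) : ℝ :=
  if h : (y : ℕ) ≠ 0 then ψ (some ⟨i, y, h⟩) else 0

lemma vecMul_indepStat {n : ℕ} {r : Fin n → ℕ} (ψ : StatIndex r → ℝ) (x : States r) :
    (ψ ᵥ* indepStat r) x = ψ none + ∑ i, coordTerm ψ i (x i) := by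
  rw [Matrix.vecMul, dotProduct, Fintype.sum_option, Fintype.sum_sigma]
  congr 1
  · simp [indepStat]
  · refine Finset.sum_congr rfl fun i _ => ?_
    simp only [indepStat, mul_ite, mul_one, mul_zero, coordTerm]
    split_ifs with h
    · rw [Finset.sum_eq_single ⟨x i, h⟩]
      · simp
      · rintro y - hy
        exact if_neg fun hxy => hy (Subtype.ext hxy.symm)
      · simp
    · refine Finset.sum_eq_zero fun y _ => if_neg fun hxy => y.2 ?_
      rw [← hxy]
      exact not_not.1 h

/-- The energy splits into the visible bias and one block per hidden unit; a unit in state `0`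
contributes nothing. -/
lemma vecMul_bipartiteStat {n m : ℕ} {r : Fin n → ℕ} {s : Fin m → ℕ}
    (θ : StatIndex r × StatIndex s → ℝ) (v : States r) (h : States s) :
    (θ ᵥ* bipartiteStat r s) (v, h) = ((fun a => θ (a, none)) ᵥ* indepStat r) v +
      ∑ j, coordTerm (fun b => ((fun a => θ (a, b)) ᵥ* indepStat r) v) j (h j) := by
  rw [← vecMul_indepStat (fun b => ((fun a => θ (a, b)) ᵥ* indepStat r) v)]
  simp only [Matrix.vecMul, dotProduct, bipartiteStat, Matrix.kroneckerMap_apply]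
  rw [Fintype.sum_prod_type_right]
  refine Finset.sum_congr rfl fun b _ => ?_
  rw [Finset.sum_mul]
  exact Finset.sum_congr rfl fun a _ => by ring

lemma bipartiteStat_none {n m : ℕ} (r : Fin n → ℕ) (s : Fin m → ℕ) (z : States r × States s) :
    bipartiteStat r s (none, none) z = 1 := by
  simp [bipartiteStat, indepStat]

lemma card_statIndex {n : ℕ} (r : Fin n → ℕ) :
    Fintype.card (StatIndex r) = ∑ i, (r i - 1) + 1 := by
  have h : ∀ k : ℕ, Fintype.card {y : Fin k // (y : ℕ) ≠ 0} = k - 1 := by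
    rintro (_ | k)
    · simp
    · rw [Fintype.card_congr (Equiv.subtypeEquivRight (q := fun y : Fin (k + 1) => y ≠ 0)
        fun y => Fin.val_ne_zero_iff), Fintype.card_subtype_compl]
      simp
  rw [Fintype.card_option, Fintype.card_sigma]
  simp [h]

/-- A set of states on which no nonzero combination of the rows of `indepStat r` vanishes. -/
def SeparatesParams {n : ℕ} {r : Fin n → ℕ} (Z : Set (States r)) : Prop :=
  ∀ ψ : StatIndex r → ℝ, (∀ v ∈ Z, (ψ ᵥ* indepStat r) v = 0) → ψ = 0

lemma HasMaximalRank.separatesParams {n : ℕ} {r : Fin n → ℕ} {Z : Finset (States r)}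
    (hZ : HasMaximalRank Z) : SeparatesParams (Z : Set (States r)) := by
  intro ψ hψ
  unfold HasMaximalRank at hZ
  rw [Matrix.rank_eq_finrank_span_row] at hZ
  have hli := linearIndependent_iff_card_eq_finrank_span.2 hZ.symm
  refine Matrix.vecMul_injective_iff.2 hli ?_
  funext z
  simpa [Matrix.vecMul, dotProduct] using hψ z z.2

lemma SeparatesParams.nonempty {n : ℕ} {r : Fin n → ℕ} {Z : Set (States r)}
    (hZ : SeparatesParams Z) : Z.Nonempty := by
  by_contra h
  rw [Set.not_nonempty_iff_eq_empty] at h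
  have := congrFun (hZ 1 (by simp [h])) none
  simp at this

end IndependenceModel

/-! ### Binary visible units: slicings of the cube by Hamming spheres -/

section Cube

variable {n : ℕ}

lemma hammingDist_cast (c v : States (binary n)) :
    (hammingDist c v : ℝ) = ∑ i, if c i ≠ v i then (1 : ℝ) else 0 := by
  simp only [hammingDist, Finset.sum_boole]

/-- For a binary coordinate, disagreement with `c i` is an affine function of the indicator of `v i
= 1`, with slope `1` or `-1`. -/
lemma exists_vecMul_eq_affine_hammingDist (c : States (binary n)) (α β : ℝ) :
    ∃ ψ : StatIndex (binary n) → ℝ,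
      ∀ v, (ψ ᵥ* indepStat (binary n)) v = α + β * hammingDist c v := by
  refine ⟨fun
    | none => α + β * ∑ i, if c i = 0 then 0 else 1
    | some ⟨i, _⟩ => β * if c i = 0 then 1 else -1, fun v => ?_⟩
  rw [vecMul_indepStat, hammingDist_cast, add_assoc, Finset.mul_sum, Finset.mul_sum,
    ← Finset.sum_add_distrib]
  congr 1
  refine Finset.sum_congr rfl fun i _ => ?_
  rcases Fin.exists_fin_two.1 ⟨c i, rfl⟩ with hc | hc <;>
    rcases Fin.exists_fin_two.1 ⟨v i, rfl⟩ with hv | hv <;> simp [coordTerm, hc, hv]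

/-- The state obtained from `c` by flipping the coordinates in `S`. -/
def flipOn (c : States (binary n)) (S : Finset (Fin n)) : States (binary n) := fun i =>
  if i ∈ S then c i + 1 else c i

lemma hammingDist_flipOn (c : States (binary n)) (S : Finset (Fin n)) :
    hammingDist c (flipOn c S) = S.card := by
  unfold hammingDist
  congr 1
  ext i
  by_cases h : i ∈ S <;> simp [flipOn, h]

/-- Two consecutive Hamming spheres separate the parameters of the independence model. -/
lemma separatesParams_spheres (c : States (binary n)) {k : ℕ} (hk : k ≤ n - 1) :
    SeparatesParams {v | hammingDist c v = k ∨ hammingDist c v = k + 1} := by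
  intro ψ hψ
  have hcoord : ∀ i (y : {y : Fin (binary n i) // (y : ℕ) ≠ 0}), ψ (some ⟨i, y⟩) = 0 := by
    intro i y
    -- With `k` coordinates other than `i` flipped, flipping `i` as well passes from one sphere to
    -- the next and isolates the parameter of `i`.
    obtain ⟨S, hS, hcard⟩ := Finset.exists_subset_card_eq
      (s := Finset.univ.erase i) (n := k) (by simpa using hk)
    have hiS : i ∉ S := fun h => Finset.notMem_erase i _ (hS h)
    have h1 := hψ (flipOn c S) (Or.inl (by rw [hammingDist_flipOn, hcard]))
    have h2 := hψ (flipOn c (insert i S))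
      (Or.inr (by rw [hammingDist_flipOn, Finset.card_insert_of_notMem hiS, hcard]))
    rw [vecMul_indepStat, ← Finset.add_sum_erase _ _ (Finset.mem_univ i)] at h1 h2
    have h3 : ∑ i' ∈ Finset.univ.erase i, coordTerm ψ i' (flipOn c (insert i S) i') =
        ∑ i' ∈ Finset.univ.erase i, coordTerm ψ i' (flipOn c S i') := by
      refine Finset.sum_congr rfl fun i' hi' => ?_
      simp [flipOn, Finset.mem_insert, Finset.ne_of_mem_erase hi']
    have h4 : coordTerm ψ i (c i + 1) = coordTerm ψ i (c i) := by
      have e1 : flipOn c S i = c i := by simp [flipOn, hiS]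
      have e2 : flipOn c (insert i S) i = c i + 1 := by simp [flipOn]
      rw [h3, e2] at h2
      rw [e1] at h1
      linarith
    obtain ⟨y, hy⟩ := y
    rcases Fin.exists_fin_two.1 ⟨y, rfl⟩ with rfl | rfl
    · simp at hy
    · rcases Fin.exists_fin_two.1 ⟨c i, rfl⟩ with hc | hc
      · simpa [coordTerm, hc] using h4
      · simpa [coordTerm, hc] using h4.symm
  obtain ⟨S, -, hcard⟩ := Finset.exists_subset_card_eq
    (s := (Finset.univ : Finset (Fin n))) (n := k) (by simp; omega)
  have h1 := hψ (flipOn c S) (Or.inl (by rw [hammingDist_flipOn, hcard]))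
  rw [vecMul_indepStat, Finset.sum_eq_zero, add_zero] at h1
  · funext a
    rcases a with _ | ⟨i, y⟩
    · exact h1
    · exact hcoord i y
  · intro i _
    rw [coordTerm]
    split_ifs
    · exact hcoord i _
    · rfl

/-- The point of tangency on the parabola which belongs to the state `y` of a hidden unit with `t`
states; the state zero plays the role of the last one. -/
noncomputable def tangentPoint (t y : ℕ) : ℝ := 2 * ((if y = 0 then t else y : ℕ) : ℝ) - 3 / 2

/-- The state of a hidden unit with `t` states that is activated by visible states at
distance `d` from the center. -/
def activeState {t : ℕ} (ht : 1 ≤ t) (d : ℕ) : Fin t :=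
  if h : d / 2 + 1 < t then ⟨d / 2 + 1, h⟩ else ⟨0, ht⟩

/-- The points `2k - 3/2` are the midpoints of `2k - 2` and `2k - 1`, so the nearest one to `d` has
`k = min (d / 2 + 1) t`. -/
lemma sq_sub_tangentPoint_lt {t : ℕ} (ht : 1 ≤ t) (d : ℕ) {y : Fin t}
    (hy : y ≠ activeState ht d) :
    ((d : ℝ) - tangentPoint t (activeState ht d)) ^ 2 < ((d : ℝ) - tangentPoint t y) ^ 2 := by
  set K : ℕ := if (activeState ht d : ℕ) = 0 then t else activeState ht d with hK
  set Y : ℕ := if (y : ℕ) = 0 then t else y with hY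
  have hKmin : K = min (d / 2 + 1) t := by
    rw [hK, activeState]
    split_ifs <;> simp_all <;> omega
  have hYt : Y ≤ t := by
    rw [hY]
    split_ifs <;> omega
  have hne : Y ≠ K := by
    intro h
    apply hy
    ext
    have h1 := y.2
    have h2 := (activeState ht d).2
    rw [hY, hK] at h
    split_ifs at h <;> omega
  -- The second integer factor is odd, so there are no ties.
  have key : (d - tangentPoint t y) ^ 2 - (d - tangentPoint t (activeState ht d)) ^ 2 =
      2 * (((K : ℤ) - Y) * (2 * d - 2 * Y - 2 * K + 3) : ℤ) := by
    simp only [tangentPoint, ← hK, ← hY]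
    push_cast
    ring
  have hpos : 0 < ((K : ℤ) - Y) * (2 * d - 2 * Y - 2 * K + 3) := by
    rcases lt_or_gt_of_ne hne with h | h
    · exact mul_pos (by omega) (by omega)
    · exact mul_pos_of_neg_of_neg (by omega) (by omega)
  have : (0 : ℝ) < (((K : ℤ) - Y) * (2 * d - 2 * Y - 2 * K + 3) : ℤ) := by exact_mod_cast hpos
  linarith

lemma mem_hammingBall_iff {c v : States (binary n)} {t : ℕ} :
    v ∈ hammingBall c (2 * (t : ℤ) - 3) ↔ hammingDist c v / 2 + 1 < t := by
  simp only [hammingBall, Finset.mem_filter, Finset.mem_univ, true_and]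
  omega

variable {m : ℕ} {s : Fin m → ℕ}

/-- The hidden state activated by the visible state `v`, for hidden units with centers `c`. -/
def activeStates (hs : ∀ j, 1 ≤ s j) (c : Fin m → States (binary n)) (v : States (binary n)) :
    States s :=
  fun j => activeState (hs j) (hammingDist (c j) v)

lemma exists_params_activating (hs : ∀ j, 1 ≤ s j) (c : Fin m → States (binary n)) :
    ∃ θ : StatIndex (binary n) × StatIndex s → ℝ, ∀ v h, h ≠ activeStates hs c v →
      (θ ᵥ* bipartiteStat (binary n) s) (v, h) <
        (θ ᵥ* bipartiteStat (binary n) s) (v, activeStates hs c v) := by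
  -- These coefficients expand `(d - t₀)² - (d - t_y)²`, where the `d²` cancels. Subtracting the
  -- state `0` term is forced because that state has no parameters.
  choose ψ hψ using fun (j : Fin m) (y : Fin (s j)) => exists_vecMul_eq_affine_hammingDist (c j)
    (tangentPoint (s j) 0 ^ 2 - tangentPoint (s j) y ^ 2)
    (2 * (tangentPoint (s j) y - tangentPoint (s j) 0))
  let θ : StatIndex (binary n) × StatIndex s → ℝ := fun
    | (_, none) => 0
    | (a, some ⟨j, y⟩) => ψ j y a
  have hval : ∀ v h, (θ ᵥ* bipartiteStat (binary n) s) (v, h) =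
      ∑ j, (((hammingDist (c j) v : ℝ) - tangentPoint (s j) 0) ^ 2 -
        ((hammingDist (c j) v : ℝ) - tangentPoint (s j) (h j)) ^ 2) := by
    intro v h
    rw [vecMul_bipartiteStat]
    have h0 : (fun a => θ (a, none)) = 0 := rfl
    rw [h0, Matrix.zero_vecMul, Pi.zero_apply, zero_add]
    refine Finset.sum_congr rfl fun j _ => ?_
    rw [coordTerm]
    split_ifs with hj
    · have h1 : (fun a => θ (a, some ⟨j, h j, hj⟩)) = ψ j (h j) := rfl
      rw [h1, hψ]
      ring
    · rw [not_not.1 hj, sub_self]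
  refine ⟨θ, fun v h hh => ?_⟩
  rw [hval, hval]
  have hle : ∀ j, ((hammingDist (c j) v : ℝ) - tangentPoint (s j) (activeStates hs c v j)) ^ 2 ≤
      ((hammingDist (c j) v : ℝ) - tangentPoint (s j) (h j)) ^ 2 := by
    intro j
    by_cases hj : h j = activeStates hs c v j
    · rw [hj]
    · exact (sq_sub_tangentPoint_lt (hs j) _ hj).le
  obtain ⟨j, hj⟩ := Function.ne_iff.1 hh
  exact Finset.sum_lt_sum (fun j _ => sub_le_sub_left (hle j) _)
    ⟨j, Finset.mem_univ _, sub_lt_sub_left (sq_sub_tangentPoint_lt (hs j) _ hj) _⟩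

/-- Peel off blocks: points outside all balls see only the bias block, and then points of ball `j`
see only the block of the active state of unit `j`. -/
lemma eq_zero_of_vecMul_activeStates (hs : ∀ j, 1 ≤ s j) (c : Fin m → States (binary n))
    (hdisj : ∀ i j, i ≠ j → Disjoint (hammingBall (c i) (2 * (s i : ℤ) - 3))
      (hammingBall (c j) (2 * (s j : ℤ) - 3)))
    (hsep : SeparatesParams {v | ∀ j, v ∉ hammingBall (c j) (2 * (s j : ℤ) - 3)})
    (θ : StatIndex (binary n) × StatIndex s → ℝ)
    (hθ : ∀ v, (θ ᵥ* bipartiteStat (binary n) s) (v, activeStates hs c v) = 0) : θ = 0 := by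
  have hout : ∀ (φ : StatIndex s → ℝ) v j, v ∉ hammingBall (c j) (2 * (s j : ℤ) - 3) →
      coordTerm φ j (activeStates hs c v j) = 0 := by
    intro φ v j hv
    rw [mem_hammingBall_iff] at hv
    simp [coordTerm, activeStates, activeState, hv]
  have hnone : (fun a => θ (a, none)) = 0 := by
    refine hsep _ fun v hv => ?_
    have := hθ v
    rwa [vecMul_bipartiteStat, Finset.sum_eq_zero fun j _ => hout _ v j (hv j), add_zero] at this
  have hsome : ∀ j (y : {y : Fin (s j) // (y : ℕ) ≠ 0}), (fun a => θ (a, some ⟨j, y⟩)) = 0 := by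
    rintro j ⟨y, hy⟩
    -- A point outside ball `j` forces `2 * s j - 2 ≤ n`, so both spheres used below fit into the
    -- cube.
    obtain ⟨u, hu⟩ := hsep.nonempty
    have hun : hammingDist (c j) u ≤ n := by
      simpa using hammingDist_le_card_fintype (x := c j) (y := u)
    have huj := hu j
    rw [mem_hammingBall_iff] at huj
    have hyt := y.2
    refine separatesParams_spheres (c j) (k := 2 * (y : ℕ) - 2) (by omega) _ fun v hv => ?_
    have hd : hammingDist (c j) v / 2 + 1 = y := by
      rcases hv with hv | hv <;> omega
    have hvj : v ∈ hammingBall (c j) (2 * (s j : ℤ) - 3) := by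
      rw [mem_hammingBall_iff]
      omega
    have hact : activeStates hs c v j = y := by
      ext
      simp [activeStates, activeState, hd]
    have := hθ v
    rw [vecMul_bipartiteStat, hnone, Matrix.zero_vecMul, Pi.zero_apply, zero_add,
      Finset.sum_eq_single j, hact] at this
    · simpa [coordTerm, hy] using this
    · intro j' _ hj'
      exact hout _ v j' (Finset.disjoint_left.1 (hdisj j j' hj'.symm) hvj)
    · simp
  funext ⟨a, b⟩
  rcases b with _ | ⟨j, y⟩
  · exact congrFun hnone a
  · exact congrFun (hsome j y) a

lemma card_params_sub_one (s : Fin m → ℕ) :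
    Fintype.card (StatIndex (binary n) × StatIndex s) - 1 = (∑ j, (s j - 1) * (n + 1)) + n := by
  rw [Fintype.card_prod, card_statIndex, card_statIndex, ← Finset.sum_mul]
  simp only [binary, Nat.add_one_sub_one, Finset.sum_const, Finset.card_univ, Fintype.card_fin,
    smul_eq_mul, mul_one]
  rw [mul_add, mul_comm, mul_one, ← add_assoc, Nat.add_sub_cancel]

/-- Injectivity of the selected linear map bounds the number of parameters by `2 ^ n`, so the
minimum in the formula is its first entry. -/
lemma expected_dim_le (hs : ∀ j, 1 ≤ s j) (c : Fin m → States (binary n))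
    (hdisj : ∀ i j, i ≠ j → Disjoint (hammingBall (c i) (2 * (s i : ℤ) - 3))
      (hammingBall (c j) (2 * (s j : ℤ) - 3)))
    (hsep : SeparatesParams {v | ∀ j, v ∉ hammingBall (c j) (2 * (s j : ℤ) - 3)}) :
    (∑ j, (s j - 1) * (n + 1)) + n ≤ 2 ^ n - 1 := by
  rw [← card_params_sub_one]
  have := card_le_card_of_selection_injective _ (eq_zero_of_vecMul_activeStates hs c hdisj hsep)
  rw [Fintype.card_pi] at this
  simp only [binary, Fintype.card_fin, Finset.prod_const, Finset.card_univ] at this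
  exact Nat.sub_le_sub_right this 1

lemma dimH_tropicalRBM (hs : ∀ j, 1 ≤ s j) (c : Fin m → States (binary n))
    (hdisj : ∀ i j, i ≠ j → Disjoint (hammingBall (c i) (2 * (s i : ℤ) - 3))
      (hammingBall (c j) (2 * (s j : ℤ) - 3)))
    (hsep : SeparatesParams {v | ∀ j, v ∉ hammingBall (c j) (2 * (s j : ℤ) - 3)}) :
    dimH (tropicalRBM (binary n) s) =
      ((min ((∑ j, (s j - 1) * (n + 1)) + n) (2 ^ n - 1) : ℕ) : ENNReal) := by
  obtain ⟨θ₀, hθ₀⟩ := exists_params_activating hs c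
  have : Nonempty (States s) := ⟨fun j => ⟨0, hs j⟩⟩
  rw [min_eq_left (expected_dim_le hs c hdisj hsep), ← card_params_sub_one]
  exact dimH_range_iSup_vecMul (bipartiteStat_none _ _) _
    (eq_zero_of_vecMul_activeStates hs c hdisj hsep) hθ₀ (constants (binary n)).mkQ
    (Submodule.ker_mkQ _) (Submodule.mkQ_surjective _)

lemma RBM_eq_range (r : Fin n → ℕ) (s : Fin m → ℕ) :
    RBM r s = Set.range fun (θ : StatIndex r × StatIndex s → ℝ) (v : States r) =>
      ∑ h, Real.exp ((θ ᵥ* bipartiteStat r s) (v, h)) /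
        ∑ w, Real.exp ((θ ᵥ* bipartiteStat r s) w) := by
  rw [RBM, bipartiteModel, ← Set.range_comp]
  rfl

lemma dimH_RBM (hs : ∀ j, 1 ≤ s j) (c : Fin m → States (binary n))
    (hdisj : ∀ i j, i ≠ j → Disjoint (hammingBall (c i) (2 * (s i : ℤ) - 3))
      (hammingBall (c j) (2 * (s j : ℤ) - 3)))
    (hsep : SeparatesParams {v | ∀ j, v ∉ hammingBall (c j) (2 * (s j : ℤ) - 3)}) :
    dimH (RBM (binary n) s) =
      ((min ((∑ j, (s j - 1) * (n + 1)) + n) (2 ^ n - 1) : ℕ) : ENNReal) := by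
  obtain ⟨θ₀, hθ₀⟩ := exists_params_activating hs c
  have : Nonempty (States s) := ⟨fun j => ⟨0, hs j⟩⟩
  rw [min_eq_left (expected_dim_le hs c hdisj hsep), ← card_params_sub_one, RBM_eq_range]
  exact dimH_range_marginal (bipartiteStat_none _ _) _
    (eq_zero_of_vecMul_activeStates hs c hdisj hsep) hθ₀

/-- The balls about all but one of the words of a code with large minimum distance satisfy the
hypotheses of the dimension formula. -/
lemma exists_centers_of_lt_maxCodeSize {t : ℕ}
    (hm : m < maxCodeSize (binary n) (4 * ((t : ℤ) - 1) - 1)) :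
    ∃ c : Fin m → States (binary n),
      (∀ i j, i ≠ j → Disjoint (hammingBall (c i) (2 * (t : ℤ) - 3))
        (hammingBall (c j) (2 * (t : ℤ) - 3))) ∧
      SeparatesParams {v | ∀ j, v ∉ hammingBall (c j) (2 * (t : ℤ) - 3)} := by
  obtain ⟨C, hC, hcard⟩ := exists_card_eq_maxCodeSize (binary n) (4 * ((t : ℤ) - 1) - 1)
  obtain ⟨e⟩ : Nonempty (Fin (m + 1) ↪ C) :=
    Function.Embedding.nonempty_of_card_le (by simpa using by omega)
  have hdist : ∀ i j, i ≠ j → 4 * ((t : ℤ) - 1) - 1 ≤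
      hammingDist (e i : States (binary n)) (e j : States (binary n)) :=
    fun i j hij => hC _ (e i).2 _ (e j).2 fun h => hij (e.injective (Subtype.ext h))
  -- Intersecting balls would have centers at distance at most `4t - 6`. The unit ball about the
  -- spare last word also avoids them: a nonempty ball has `t ≥ 2`, whence `2t - 2 < 4t - 5`.
  refine ⟨fun j => e j.castSucc, fun i j hij => Finset.disjoint_left.2 fun v hi hj => ?_,
    fun ψ hψ => separatesParams_spheres (e (Fin.last m) : States (binary n)) (Nat.zero_le _) ψ
      fun v hv => hψ v fun j hj => ?_⟩
  · simp only [hammingBall, Finset.mem_filter, Finset.mem_univ, true_and] at hi hj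
    have h1 := hdist _ _ (fun h => hij (Fin.castSucc_injective m h))
    have h2 := hammingDist_triangle_right (e i.castSucc : States (binary n))
      (e j.castSucc : States (binary n)) v
    omega
  · simp only [hammingBall, Finset.mem_filter, Finset.mem_univ, true_and] at hj
    have h1 := hdist _ _ (Fin.castSucc_ne_last j)
    have h2 := hammingDist_triangle_right (e j.castSucc : States (binary n))
      (e (Fin.last m) : States (binary n)) v
    rcases hv with hv | hv <;> omega

end Cube

theorem mainTheorem8 (n : ℕ) :
    (∀ (m : ℕ) (s : Fin m → ℕ), (∀ j, 1 ≤ s j) →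
      ∀ c : Fin m → States (binary n),
        (∀ i j, i ≠ j →
          Disjoint (hammingBall (c i) (2 * (s i : ℤ) - 3))
            (hammingBall (c j) (2 * (s j : ℤ) - 3))) →
        HasMaximalRank
          (Finset.univ.biUnion fun j => hammingBall (c j) (2 * (s j : ℤ) - 3))ᶜ →
        dimH (tropicalRBM (binary n) s) =
          ((min ((∑ j, (s j - 1) * (n + 1)) + n) (2 ^ n - 1) : ℕ) : ENNReal)) ∧
    (∀ m s : ℕ, 1 ≤ s →
      m < maxCodeSize (binary n) (4 * ((s : ℤ) - 1) - 1) →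
      dimH (RBM (binary n) (fun _ : Fin m => s)) =
        ((min (m * (s - 1) * (n + 1) + n) (2 ^ n - 1) : ℕ) : ENNReal)) ∧
    (∀ d : ℤ,
      (2 : ℝ) ^ ((n : ℤ) -
          ⌈Real.logb 2 (1 + ∑ j ∈ Finset.range (d - 1).toNat, ((n - 1).choose j : ℝ))⌉) ≤
        (maxCodeSize (binary n) d : ℝ)) := by
  refine ⟨fun m s hs c hdisj hrank => dimH_tropicalRBM hs c hdisj ?_, fun m s hs hm => ?_,
    gilbert_varshamov n⟩
  · have := hrank.separatesParams
    simpa [Set.compl_def] using this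
  · obtain ⟨c, hdisj, hsep⟩ := exists_centers_of_lt_maxCodeSize hm
    have := dimH_RBM (s := fun _ : Fin m => s) (fun _ => hs) c hdisj hsep
    rw [Finset.sum_const, Finset.card_univ, Fintype.card_fin, smul_eq_mul, ← mul_assoc] at this
    exact this
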